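/- Let $L\ge 1$ be an integer, let $0<\alpha<\beta$ be real numbers, and put $\rho=\alpha/\beta\in(0,1)$. For $k\ge 0$ let $\tilde u(k)=\rho^{1+L+\cdots+L^{k-1}}$ (so $\tilde u(0)=1$), and for $k\ge1$ let $$\pi(k)=L^{k-1}\rho^{L+L^2+\cdots+L^{k-1}},$$ that is, $\pi(k)=L^{k-1}\rho^{(L^k-L)/(L-1)}$ if $L\ge2$ and $\pi(k)=\rho^{k-1}$ if $L=1$. Let $L_2(\pi)$ be the real Hilbert space of sequences $x=(x(k))_{k\ge0}$ with $x(0)=0$ and $\|x\|_{L_2(\pi)}^2=\sum_{k\ge1}x(k)^2\pi(k)^{-1}<\infty$, with inner product $(x,y)_{L_2(\pi)}=\sum_{k\ge1}x(k)y(k)\pi(k)^{-1}$. For a sequence $x$ with $x(0)=0$ let $\mathcal K x(0)=0$ and $$\mathcal K x(k)=\alpha L\,\tilde u(k-1)^{L-1}x(k-1)-\bigl(\alpha L\,\tilde u(k)^{L-1}+\beta\bigr)x(k)+\beta x(k+1),\qquad k\ge1 .$$ Theorem (spectral gap). The operator $\mathcal K$ maps $L_2(\pi)$ into itself and is bounded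 and self-adjoint on $L_2(\pi)$. The spectrum of $-\mathcal K$ on $L_2(\pi)$ has a least element $\gamma$, and $0<\gamma\le\beta$. For every $z_0\in L_2(\pi)$ the function $z_t=\mathrm e^{\mathcal K t}z_0$, $t\ge0$, is the unique solution in $L_2(\pi)$ (differentiable in norm) of $\dot z_t=\mathcal K z_t$ starting at $z_0$, and $$\|\mathrm e^{\mathcal K t}z_0\|_{L_2(\pi)}\le \mathrm e^{-\gamma t}\|z_0\|_{L_2(\pi)},\qquad t\ge0 .$$ -/

import Mathlib

noncomputable section

namespace QueueGap

/-- The stationary profile `ũ(k) = ρ ^ (1 + L + ⋯ + L^(k-1))`, that is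
`ρ ^ ((L^k - 1) / (L - 1))` for `L ≥ 2` and `ρ ^ k` for `L = 1`. -/
def uTilde (ρ : ℝ) (L k : ℕ) : ℝ :=
  ρ ^ (∑ i ∈ Finset.range k, L ^ i)

/-- The potential coefficients `π(k) = L^(k-1) ρ ^ (L + L^2 + ⋯ + L^(k-1))`, `k ≥ 1`, that is
`L^(k-1) ρ ^ ((L^k - L) / (L - 1))` for `L ≥ 2` and `ρ ^ (k-1)` for `L = 1`.
The value at `k = 0` is never used. -/
def potential (ρ : ℝ) (L k : ℕ) : ℝ :=
  (L : ℝ) ^ (k - 1) * ρ ^ (∑ i ∈ Finset.Ico 1 k, L ^ i)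

theorem potential_pos {ρ : ℝ} {L : ℕ} (hρ : 0 < ρ) (hL : 1 ≤ L) (k : ℕ) (_hk : 1 ≤ k) :
    0 < potential ρ L k := by
  have : (0 : ℝ) < L := by exact_mod_cast hL
  unfold potential
  positivity

/-- The closed form of the potential coefficients for `L ≥ 2` (the division is exact). -/
theorem potential_eq (ρ : ℝ) {L k : ℕ} (hL : 2 ≤ L) (hk : 1 ≤ k) :
    potential ρ L k = (L : ℝ) ^ (k - 1) * ρ ^ ((L ^ k - L) / (L - 1)) := by
  unfold potential
  congr 2
  refine (Nat.div_eq_of_eq_mul_left (by omega) ?_).symm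
  have h1 := geom_sum_mul_add (L - 1) k
  rw [Nat.sub_add_cancel (by omega : 1 ≤ L), Finset.range_eq_Ico,
    Finset.sum_eq_sum_Ico_succ_bot (by omega)] at h1
  simp only [pow_zero, zero_add, add_mul, one_mul] at h1
  omega

/-- The linearized operator on sequences indexed by `ℕ`, with `ũ = uTilde (α / β) L`:
`𝒦 x (k) = α L ũ(k-1)^(L-1) x(k-1) - (α L ũ(k)^(L-1) + β) x(k) + β x(k+1)` for `k ≥ 1`,
and `𝒦 x (0) = 0`. -/
def linK (α β : ℝ) (L : ℕ) (x : ℕ → ℝ) : ℕ → ℝ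
  | 0 => 0
  | k + 1 =>
      α * L * uTilde (α / β) L k ^ (L - 1) * x k
        - (α * L * uTilde (α / β) L (k + 1) ^ (L - 1) + β) * x (k + 1)
        + β * x (k + 2)

/-- The explicit form of the linearized operator, with `ρ = α / β`. -/
theorem linK_succ {α β : ℝ} {L : ℕ} (hβ : β ≠ 0) (hL : 1 ≤ L) (x : ℕ → ℝ) (k : ℕ) :
    linK α β L x (k + 1) =
      β * L * (α / β) ^ (L ^ k) * x k
        - (β * L * (α / β) ^ (L ^ (k + 1)) + β) * x (k + 1) + β * x (k + 2) := by
  have key : ∀ n : ℕ, α * L * uTilde (α / β) L n ^ (L - 1) = β * L * (α / β) ^ (L ^ n) := by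
    intro n
    have h1 : (∑ i ∈ Finset.range n, L ^ i) * (L - 1) + 1 = L ^ n := by
      obtain ⟨m, rfl⟩ : ∃ m, L = m + 1 := ⟨L - 1, by omega⟩
      exact geom_sum_mul_add m n
    rw [uTilde, ← pow_mul, ← h1, pow_succ]
    field_simp
  simp only [linK, key]

/-- The space of real sequences `x` with `x(0) = 0` and `∑_{k ≥ 1} x(k)^2 w(k)⁻¹ < ∞`, as a
subspace of the space of all sequences (the term of index `0` of the sum vanishes). -/
def l2Submodule (w : ℕ → ℝ) (hw : ∀ k, 1 ≤ k → 0 < w k) : Submodule ℝ (ℕ → ℝ) where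
  carrier := {x | x 0 = 0 ∧ Summable fun k => x k ^ 2 * (w k)⁻¹}
  zero_mem' := by simp
  add_mem' := by
    rintro x y ⟨hx0, hx⟩ ⟨hy0, hy⟩
    refine ⟨by simp [hx0, hy0], ?_⟩
    refine Summable.of_nonneg_of_le (fun k => ?_) (fun k => ?_)
      ((hx.mul_left 2).add (hy.mul_left 2))
    · rcases Nat.eq_zero_or_pos k with rfl | hk
      · simp [hx0, hy0]
      · have := hw k hk
        positivity
    · rcases Nat.eq_zero_or_pos k with rfl | hk
      · simp [hx0, hy0]
      · have h : (0 : ℝ) ≤ (w k)⁻¹ := (inv_pos.2 (hw k hk)).le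
        simp only [Pi.add_apply]
        nlinarith [mul_nonneg (sq_nonneg (x k - y k)) h]
  smul_mem' := by
    rintro c x ⟨hx0, hx⟩
    refine ⟨by simp [hx0], ?_⟩
    refine (hx.mul_left (c ^ 2)).congr (fun k => ?_)
    simp only [Pi.smul_apply, smul_eq_mul]
    ring

/-- The Hilbert space `L_2(w)` of a weight `w > 0` on `{1, 2, …}`. -/
def L2 (w : ℕ → ℝ) (hw : ∀ k, 1 ≤ k → 0 < w k) : Type :=
  l2Submodule w hw

namespace L2

variable {w : ℕ → ℝ} {hw : ∀ k, 1 ≤ k → 0 < w k}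

/-- Termwise addition on `L_2(w)`. -/
@[reducible] def addCommGroup : AddCommGroup (L2 w hw) :=
  inferInstanceAs (AddCommGroup (l2Submodule w hw))

section algebra

attribute [local instance] addCommGroup

/-- Termwise scalar multiplication on `L_2(w)`. -/
@[reducible] def module : Module ℝ (L2 w hw) :=
  inferInstanceAs (Module ℝ (l2Submodule w hw))

attribute [local instance] module

/-- The underlying sequence of an element of `L_2(w)`. -/
def seq (x : L2 w hw) : ℕ → ℝ := x.1

theorem seq_injective : Function.Injective (seq : L2 w hw → ℕ → ℝ) :=
  Subtype.val_injective

@[simp] theorem seq_zero_apply (x : L2 w hw) : x.seq 0 = 0 := x.2.1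

theorem summable_sq (x : L2 w hw) : Summable fun k => x.seq k ^ 2 * (w k)⁻¹ := x.2.2

theorem seq_add_aux (x y : L2 w hw) : (x + y).seq = x.seq + y.seq := rfl

theorem seq_smul_aux (c : ℝ) (x : L2 w hw) : (c • x).seq = c • x.seq := rfl

theorem seq_zero_aux : (0 : L2 w hw).seq = 0 := rfl

theorem term_nonneg (x : L2 w hw) (k : ℕ) : 0 ≤ x.seq k ^ 2 * (w k)⁻¹ := by
  rcases Nat.eq_zero_or_pos k with rfl | hk
  · simp
  · have := hw k hk
    positivity

theorem summable_mul (x y : L2 w hw) : Summable fun k => x.seq k * y.seq k * (w k)⁻¹ := by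
  have h := ((x + y).summable_sq.sub x.summable_sq).sub y.summable_sq
  refine (h.mul_left 2⁻¹).congr (fun k => ?_)
  simp only [seq_add_aux, Pi.add_apply]
  ring

/-- The inner product `(x, y) = ∑_{k ≥ 1} x(k) y(k) w(k)⁻¹` (the term of index `0` vanishes). -/
@[reducible] def core : InnerProductSpace.Core ℝ (L2 w hw) where
  inner x y := ∑' k, x.seq k * y.seq k * (w k)⁻¹
  conj_inner_symm x y := by
    simp only [conj_trivial]
    exact tsum_congr fun k => by ring
  re_inner_nonneg x := by
    simp only [RCLike.re_to_real]
    refine tsum_nonneg fun k => ?_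
    have := x.term_nonneg k
    rwa [sq] at this
  add_left x y z := by
    rw [← (x.summable_mul z).tsum_add (y.summable_mul z)]
    exact tsum_congr fun k => by simp only [seq_add_aux, Pi.add_apply]; ring
  smul_left x y r := by
    simp only [conj_trivial]
    rw [← tsum_mul_left]
    exact tsum_congr fun k => by simp only [seq_smul_aux, Pi.smul_apply, smul_eq_mul]; ring
  definite x hx := by
    have h : ∑' k, x.seq k ^ 2 * (w k)⁻¹ = 0 := by
      rw [← hx]
      exact tsum_congr fun k => by ring
    have h2 := (hasSum_zero_iff_of_nonneg x.term_nonneg).1 (h ▸ x.summable_sq.hasSum)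
    apply seq_injective
    funext k
    rcases Nat.eq_zero_or_pos k with rfl | hk
    · simp
    · have h3 := congrFun h2 k
      have h4 := (hw k hk).ne'
      change x.seq k = 0
      simpa [h4] using h3

instance : NormedAddCommGroup (L2 w hw) := core.toNormedAddCommGroup

instance : InnerProductSpace ℝ (L2 w hw) := InnerProductSpace.ofCore core.toCore

end algebra

@[simp] theorem seq_add (x y : L2 w hw) : (x + y).seq = x.seq + y.seq := rfl

@[simp] theorem seq_smul (c : ℝ) (x : L2 w hw) : (c • x).seq = c • x.seq := rfl

@[simp] theorem seq_zero : (0 : L2 w hw).seq = 0 := rfl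

theorem inner_def (x y : L2 w hw) : inner ℝ x y = ∑' k, x.seq k * y.seq k * (w k)⁻¹ := rfl

theorem norm_sq (x : L2 w hw) : ‖x‖ ^ 2 = ∑' k, x.seq k ^ 2 * (w k)⁻¹ := by
  rw [← real_inner_self_eq_norm_sq, inner_def]
  exact tsum_congr fun k => by ring

/-- The identification of `L_2(w)` with `ℓ²` by `x ↦ (x(k+1) / √w(k+1))_{k ≥ 0}`. -/
def toLp : L2 w hw ≃ₗᵢ[ℝ] lp (fun _ : ℕ => ℝ) 2 where
  toFun x := ⟨fun k => x.seq (k + 1) * (√(w (k + 1)))⁻¹, by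
    refine (memℓp_gen_iff (by norm_num)).2 ?_
    refine ((summable_nat_add_iff 1).2 x.summable_sq).congr fun k => ?_
    have h := hw (k + 1) (by omega)
    simp [mul_pow, inv_pow, Real.sq_sqrt h.le]⟩
  invFun y := ⟨fun k => Nat.casesOn k 0 fun j => y j * √(w (j + 1)), rfl, by
    refine (summable_nat_add_iff 1).1 ?_
    have hy := (memℓp_gen_iff (by norm_num)).1 y.2
    refine hy.congr fun k => ?_
    have h := hw (k + 1) (by omega)
    have h' := h.ne'
    simp [mul_pow, Real.sq_sqrt h.le, h']⟩
  left_inv x := by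
    apply seq_injective
    funext k
    cases k with
    | zero => exact x.2.1.symm
    | succ k =>
      have h := (Real.sqrt_pos.2 (hw (k + 1) (by omega))).ne'
      simp [seq, h]
  right_inv y := by
    ext k
    have h := (Real.sqrt_pos.2 (hw (k + 1) (by omega))).ne'
    simp [seq, h]
  map_add' x y := by
    ext k
    exact add_mul _ _ _
  map_smul' c x := by
    ext k
    exact mul_assoc _ _ _
  norm_map' x := by
    rw [← sq_eq_sq₀ (norm_nonneg _) (norm_nonneg _), norm_sq, x.summable_sq.tsum_eq_zero_add,
      ← real_inner_self_eq_norm_sq, lp.inner_eq_tsum]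
    simp only [seq_zero_apply, ne_eq, OfNat.ofNat_ne_zero, not_false_eq_true, zero_pow, zero_mul,
      zero_add]
    refine tsum_congr fun k => ?_
    have h := hw (k + 1) (by omega)
    change inner ℝ (x.seq (k + 1) * (√(w (k + 1)))⁻¹) (x.seq (k + 1) * (√(w (k + 1)))⁻¹) = _
    rw [real_inner_self_eq_norm_sq, Real.norm_eq_abs, sq_abs, mul_pow, inv_pow, Real.sq_sqrt h.le]

instance : CompleteSpace (L2 w hw) :=
  (toLp (w := w) (hw := hw)).toIsometryEquiv.completeSpace

end L2

/-- The Hilbert space `L_2(π)` of the weight `π` of the parameters `ρ > 0` and `L ≥ 1`. -/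
abbrev L2Pi (ρ : ℝ) (L : ℕ) (hρ : 0 < ρ) (hL : 1 ≤ L) : Type :=
  L2 (potential ρ L) (potential_pos hρ hL)

end QueueGap

end

noncomputable section

namespace QueueGap

section Hilbert

variable {H : Type*} [NormedAddCommGroup H] [InnerProductSpace ℝ H] [CompleteSpace H]

theorem norm_sq_le_of_nonneg_of_isSelfAdjoint {B : H →L[ℝ] H} (hB : IsSelfAdjoint B)
    (hpos : ∀ x, 0 ≤ inner ℝ (B x) x) (x : H) : ‖B x‖ ^ 2 ≤ ‖B‖ * inner ℝ (B x) x := by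
  have hsymm : ∀ x y, inner ℝ (B x) y = inner ℝ x (B y) :=
    (ContinuousLinearMap.isSelfAdjoint_iff_isSymmetric.1 hB)
  let F : LinearMap.BilinForm ℝ H := (innerₗ H).comp (B : H →ₗ[ℝ] H)
  have hF : ∀ x y, F x y = inner ℝ (B x) y := fun _ _ => rfl
  have hcs := LinearMap.BilinForm.apply_mul_apply_le_of_forall_zero_le F
    (fun x => by rw [hF]; exact hpos x) x (B x)
  rw [hF, hF, hF, hF, real_inner_self_eq_norm_sq, hsymm (B x) x, real_inner_self_eq_norm_sq] at hcs
  rcases eq_or_ne (B x) 0 with h0 | h0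
  · simp [h0]
  have hn : 0 < ‖B x‖ ^ 2 := by positivity
  have h1 : inner ℝ (B (B x)) (B x) ≤ ‖B‖ * ‖B x‖ ^ 2 :=
    calc inner ℝ (B (B x)) (B x) ≤ ‖B (B x)‖ * ‖B x‖ := real_inner_le_norm _ _
      _ ≤ ‖B‖ * ‖B x‖ * ‖B x‖ := by gcongr; exact B.le_opNorm _
      _ = _ := by ring
  have h2 := mul_le_mul_of_nonneg_left h1 (hpos x)
  nlinarith

/-- The infimum of the quadratic form of a bounded self-adjoint operator on the unit sphere is
the least element of its spectrum. -/
theorem exists_isLeast_spectrum [Nontrivial H] {A : H →L[ℝ] H} (hA : IsSelfAdjoint A) :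
    ∃ γ : ℝ, IsLeast (spectrum ℝ A) γ ∧ IsGreatest {c | ∀ x, c * ‖x‖ ^ 2 ≤ inner ℝ (A x) x} γ := by
  set S : Set ℝ := {c | ∀ x, c * ‖x‖ ^ 2 ≤ inner ℝ (A x) x}
  have hne : S.Nonempty := ⟨-‖A‖, fun x => by
    have h1 := (abs_le.1 (abs_real_inner_le_norm (A x) x)).1
    have h2 := mul_le_mul_of_nonneg_right (A.le_opNorm x) (norm_nonneg x)
    nlinarith⟩
  obtain ⟨e, he⟩ := exists_ne (0 : H)
  have hen : 0 < ‖e‖ ^ 2 := by positivity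
  have hbdd : BddAbove S := ⟨inner ℝ (A e) e / ‖e‖ ^ 2, fun c hc => (le_div_iff₀ hen).2 (hc e)⟩
  have hmem : sSup S ∈ S := fun x => by
    rcases eq_or_ne x 0 with rfl | hx
    · simp
    have hxn : 0 < ‖x‖ ^ 2 := by positivity
    exact (le_div_iff₀ hxn).1 (csSup_le hne fun c hc => (le_div_iff₀ hxn).2 (hc x))
  have hsub : ∀ (c : ℝ) (x : H), inner ℝ ((A - algebraMap ℝ (H →L[ℝ] H) c) x) x
      = inner ℝ (A x) x - c * ‖x‖ ^ 2 := fun c x => by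
    rw [Algebra.algebraMap_eq_smul_one, sub_apply, inner_sub_left,
      smul_apply, one_apply_eq_self, real_inner_smul_left,
      real_inner_self_eq_norm_sq]
  refine ⟨sSup S, ⟨?_, ?_⟩, hmem, fun c hc => le_csSup hbdd hc⟩
  · rw [spectrum.mem_iff, IsUnit.sub_iff]
    intro hu
    set B := A - algebraMap ℝ (H →L[ℝ] H) (sSup S) with hBdef
    have hB : IsSelfAdjoint B := hA.sub (IsSelfAdjoint.algebraMap _ (IsSelfAdjoint.all _))
    have hpos : ∀ x, 0 ≤ inner ℝ (B x) x := fun x => by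
      rw [hBdef, hsub]; exact sub_nonneg.2 (hmem x)
    obtain ⟨u, hu⟩ := hu
    set C : H →L[ℝ] H := ↑u⁻¹
    have hCB : ∀ x, C (B x) = x := fun x => by
      have : C * B = 1 := by rw [← hu]; exact u.inv_mul
      exact congrArg (fun f : H →L[ℝ] H => f x) this
    set M := ‖C‖ ^ 2 * ‖B‖ + 1
    have hM : 0 < M := by positivity
    have hle : ∀ x, ‖x‖ ^ 2 ≤ M * inner ℝ (B x) x := fun x => by
      calc ‖x‖ ^ 2 = ‖C (B x)‖ ^ 2 := by rw [hCB]
        _ ≤ (‖C‖ * ‖B x‖) ^ 2 := by gcongr; exact C.le_opNorm _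
        _ = ‖C‖ ^ 2 * ‖B x‖ ^ 2 := by ring
        _ ≤ ‖C‖ ^ 2 * (‖B‖ * inner ℝ (B x) x) := by
          gcongr; exact norm_sq_le_of_nonneg_of_isSelfAdjoint hB hpos x
        _ ≤ M * inner ℝ (B x) x := by
          have := hpos x
          simp only [M]; linarith
    have : sSup S + M⁻¹ ∈ S := fun x => by
      have h1 := hle x
      rw [hBdef, hsub, ← inv_mul_le_iff₀ hM] at h1
      linarith
    have h2 := le_csSup hbdd this
    have : 0 < M⁻¹ := by positivity
    linarith
  · intro c hc
    by_contra! hlt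
    rw [spectrum.mem_iff, IsUnit.sub_iff] at hc
    refine hc (ContinuousLinearMap.isUnit_of_forall_le_norm_inner_map _
      (c := ⟨sSup S - c, (sub_pos.2 hlt).le⟩) (sub_pos.2 hlt) fun x => ?_)
    refine le_trans ?_ (Real.le_norm_self _)
    rw [hsub]
    have := hmem x
    change ‖x‖ ^ 2 * (sSup S - c) ≤ _
    linarith

theorem hasDerivAt_exp_smul_apply (K : H →L[ℝ] H) (z : H) (t : ℝ) :
    HasDerivAt (fun s : ℝ => NormedSpace.exp (s • K) z) (K (NormedSpace.exp (t • K) z)) t :=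
  (hasDerivAt_exp_smul_const' K t).clm_apply (hasDerivAt_const t z) |>.congr_deriv (by simp)

theorem eq_exp_smul_apply_of_hasDerivWithinAt (K : H →L[ℝ] H) {z : ℝ → H}
    (hz : ∀ t : ℝ, 0 ≤ t → HasDerivWithinAt z (K (z t)) (Set.Ici 0) t) {t : ℝ} (ht : 0 ≤ t) :
    z t = NormedSpace.exp (t • K) (z 0) := by
  refine ODE_solution_unique (v := fun _ => K) (K := ‖K‖₊) (a := 0) (b := t)
    (fun _ => K.lipschitz) (fun s hs => ((hz s hs.1).continuousWithinAt).mono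
      Set.Icc_subset_Ici_self) (fun s hs => (hz s hs.1).mono (Set.Ici_subset_Ici.2 hs.1))
    (fun s _ => (hasDerivAt_exp_smul_apply K (z 0) s).continuousAt.continuousWithinAt)
    (fun s _ => (hasDerivAt_exp_smul_apply K (z 0) s).hasDerivWithinAt) (by simp) ⟨ht, le_rfl⟩

theorem norm_exp_smul_apply_le {K : H →L[ℝ] H} {γ : ℝ}
    (hγ : ∀ x, γ * ‖x‖ ^ 2 ≤ inner ℝ ((-K) x) x) (z : H) {t : ℝ} (ht : 0 ≤ t) :
    ‖NormedSpace.exp (t • K) z‖ ≤ Real.exp (-γ * t) * ‖z‖ := by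
  set y : ℝ → H := fun s => NormedSpace.exp (s • K) z with hy
  have hd : ∀ s, HasDerivAt (fun s => Real.exp (2 * γ * s) * ‖y s‖ ^ 2)
      (Real.exp (2 * γ * s) * (2 * γ) * ‖y s‖ ^ 2
        + Real.exp (2 * γ * s) * (2 * inner ℝ (y s) (K (y s)))) s := fun s =>
    (((hasDerivAt_id s).const_mul (2 * γ)).exp.congr_deriv (by simp)).mul
      (hasDerivAt_exp_smul_apply K z s).norm_sq
  have hanti : Antitone fun s => Real.exp (2 * γ * s) * ‖y s‖ ^ 2 :=
    antitone_of_hasDerivAt_nonpos hd fun s => by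
      have h1 := hγ (y s)
      rw [neg_apply, inner_neg_left, real_inner_comm] at h1
      have h2 := Real.exp_pos (2 * γ * s)
      change Real.exp (2 * γ * s) * (2 * γ) * ‖y s‖ ^ 2
        + Real.exp (2 * γ * s) * (2 * inner ℝ (y s) (K (y s))) ≤ 0
      nlinarith
  have h0 : Real.exp (2 * γ * t) * ‖y t‖ ^ 2 ≤ ‖z‖ ^ 2 := by simpa [hy] using hanti ht
  refine (sq_le_sq₀ (norm_nonneg _) (by positivity)).1 ?_
  calc ‖y t‖ ^ 2 = Real.exp (-γ * t) ^ 2 * (Real.exp (2 * γ * t) * ‖y t‖ ^ 2) := by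
        rw [← mul_assoc, ← Real.exp_nat_mul, ← Real.exp_add]
        simp [show (2 : ℝ) * (γ * t) = 2 * γ * t by ring]
    _ ≤ Real.exp (-γ * t) ^ 2 * ‖z‖ ^ 2 := by gcongr
    _ = _ := by ring

/-- The operator `-β (1 - T)† (1 - T)`. -/
def negGram (β : ℝ) (T : H →L[ℝ] H) : H →L[ℝ] H := -(β • (star (1 - T) * (1 - T)))

theorem negGram_apply (β : ℝ) (T : H →L[ℝ] H) (x : H) :
    negGram β T x = -(β • ((x - T x) - ContinuousLinearMap.adjoint T (x - T x))) := by
  simp only [negGram, star_sub, star_one, ContinuousLinearMap.star_eq_adjoint]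
  rfl

theorem inner_neg_negGram_apply (β : ℝ) (T : H →L[ℝ] H) (x : H) :
    inner ℝ ((-negGram β T) x) x = β * ‖x - T x‖ ^ 2 := by
  rw [neg_apply, negGram_apply, neg_neg, real_inner_smul_left, inner_sub_left,
    ContinuousLinearMap.adjoint_inner_left, ← inner_sub_right, real_inner_self_eq_norm_sq]

theorem isSelfAdjoint_negGram (β : ℝ) (T : H →L[ℝ] H) : IsSelfAdjoint (negGram β T) :=
  ((IsSelfAdjoint.all β).smul (IsSelfAdjoint.star_mul_self (1 - T))).neg

/-- The spectral gap of `-β (1 - T)† (1 - T)` when `1 - T` is bounded below and does not increase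
the norm of some nonzero vector. -/
theorem exists_gap_negGram {β : ℝ} (hβ : 0 < β) {T : H →L[ℝ] H} {δ : ℝ} (hδ : 0 < δ)
    (hlow : ∀ x, δ * ‖x‖ ^ 2 ≤ ‖x - T x‖ ^ 2) {x : H} (hx0 : x ≠ 0)
    (hx : ‖x - T x‖ ^ 2 ≤ ‖x‖ ^ 2) :
    ∃ γ : ℝ, IsLeast (spectrum ℝ (-negGram β T)) γ ∧ 0 < γ ∧ γ ≤ β ∧
      ∀ y, γ * ‖y‖ ^ 2 ≤ inner ℝ ((-negGram β T) y) y := by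
  have : Nontrivial H := ⟨x, 0, hx0⟩
  obtain ⟨γ, hspec, hmem, hgr⟩ := exists_isLeast_spectrum (isSelfAdjoint_negGram β T).neg
  refine ⟨γ, hspec, (mul_pos hβ hδ).trans_le (hgr fun y => ?_), ?_, hmem⟩
  · rw [inner_neg_negGram_apply, mul_assoc]
    exact mul_le_mul_of_nonneg_left (hlow y) hβ.le
  · have h1 := hmem x
    rw [inner_neg_negGram_apply] at h1
    have h2 : 0 < ‖x‖ ^ 2 := by positivity
    exact le_of_mul_le_mul_right (h1.trans (mul_le_mul_of_nonneg_left hx hβ.le)) h2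

end Hilbert

namespace L2

variable {w : ℕ → ℝ} {hw : ∀ k, 1 ≤ k → 0 < w k} {r : ℕ → ℝ}

/-- The indicator sequence of `n ≥ 1`. -/
def single (n : ℕ) (hn : 1 ≤ n) : L2 w hw :=
  ⟨Pi.single n 1, by simp [show (0 : ℕ) ≠ n by omega],
    summable_of_ne_finset_zero (s := {n}) fun k hk => by
      simp [Finset.notMem_singleton.1 hk]⟩

@[simp] theorem seq_single (n : ℕ) (hn : 1 ≤ n) :
    (single n hn : L2 w hw).seq = Pi.single n 1 := rfl

@[simp] theorem seq_neg (x : L2 w hw) : (-x).seq = -x.seq := rfl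

@[simp] theorem seq_sub (x y : L2 w hw) : (x - y).seq = x.seq - y.seq := by
  rw [sub_eq_add_neg, sub_eq_add_neg, seq_add, seq_neg]

theorem inner_single (x : L2 w hw) (n : ℕ) (hn : 1 ≤ n) :
    inner ℝ x (single n hn) = x.seq n * (w n)⁻¹ := by
  rw [inner_def, tsum_eq_single n fun k hk => by simp [hk]]
  simp

theorem norm_single_sq (n : ℕ) (hn : 1 ≤ n) : ‖(single n hn : L2 w hw)‖ ^ 2 = (w n)⁻¹ := by
  rw [← real_inner_self_eq_norm_sq, inner_single]
  simp

/-- The terms `r(k) x(k)` of the shifted sequence, placed at `k + 1`. -/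
def shiftSeq (r x : ℕ → ℝ) : ℕ → ℝ
  | 0 => 0
  | k + 1 => r k * x k

theorem shift_term (hr : ∀ k, 1 ≤ k → 0 < r k) (hwr : ∀ k, 1 ≤ k → w (k + 1) = r k * w k)
    (x : L2 w hw) (k : ℕ) :
    shiftSeq r x.seq (k + 1) ^ 2 * (w (k + 1))⁻¹ = r k * (x.seq k ^ 2 * (w k)⁻¹) := by
  rcases Nat.eq_zero_or_pos k with rfl | hk
  · simp [shiftSeq]
  · have h1 := (hr k hk).ne'
    have h2 := (hw k hk).ne'
    rw [shiftSeq, hwr k hk]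
    field_simp

theorem shift_term_le {M : ℝ} (hr : ∀ k, 1 ≤ k → 0 < r k)
    (hwr : ∀ k, 1 ≤ k → w (k + 1) = r k * w k) (hM : ∀ k, r k ≤ M) (x : L2 w hw) (k : ℕ) :
    shiftSeq r x.seq (k + 1) ^ 2 * (w (k + 1))⁻¹ ≤ M * (x.seq k ^ 2 * (w k)⁻¹) := by
  rw [shift_term hr hwr]
  exact mul_le_mul_of_nonneg_right (hM k) (x.term_nonneg k)

/-- The shift `x ↦ (r(k-1) x(k-1))_{k ≥ 1}` on `L_2(w)`, where `w(k+1) = r(k) w(k)`. -/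
def shift {M : ℝ} (hr : ∀ k, 1 ≤ k → 0 < r k) (hwr : ∀ k, 1 ≤ k → w (k + 1) = r k * w k)
    (hM : ∀ k, r k ≤ M) : L2 w hw →L[ℝ] L2 w hw :=
  LinearMap.mkContinuous
    { toFun x := ⟨shiftSeq r x.seq, rfl, (summable_nat_add_iff 1).1 <|
        Summable.of_nonneg_of_le
          (fun k => mul_nonneg (sq_nonneg _) (inv_nonneg.2 (hw (k + 1) (by omega)).le))
          (shift_term_le hr hwr hM x) (x.summable_sq.mul_left M)⟩
      map_add' x y := seq_injective <| by
        funext k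
        cases k with
        | zero => exact (add_zero (0 : ℝ)).symm
        | succ k => exact mul_add _ _ _
      map_smul' c x := seq_injective <| by
        funext k
        cases k with
        | zero => exact (mul_zero c).symm
        | succ k => exact mul_left_comm _ _ _ }
    √M fun x => by
      have hM0 : 0 ≤ M := (hr 1 le_rfl).le.trans (hM 1)
      rw [← sq_le_sq₀ (norm_nonneg _) (by positivity), mul_pow, Real.sq_sqrt hM0, norm_sq, norm_sq,
        (summable_sq _).tsum_eq_zero_add, ← tsum_mul_left]
      simp only [seq_zero_apply, ne_eq, OfNat.ofNat_ne_zero, not_false_eq_true, zero_pow, zero_mul,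
        zero_add]
      exact ((summable_nat_add_iff 1).2 (summable_sq _)).tsum_le_tsum (shift_term_le hr hwr hM x)
        (x.summable_sq.mul_left M)

section shift

variable {M : ℝ} (hr : ∀ k, 1 ≤ k → 0 < r k) (hwr : ∀ k, 1 ≤ k → w (k + 1) = r k * w k)
  (hM : ∀ k, r k ≤ M)

theorem seq_shift (x : L2 w hw) : (shift hr hwr hM x).seq = shiftSeq r x.seq := rfl

theorem shift_single (n : ℕ) (hn : 1 ≤ n) :
    shift hr hwr hM (single n hn : L2 w hw) = r n • single (n + 1) (by omega) := by
  apply seq_injective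
  funext k
  cases k with
  | zero => simp
  | succ k =>
    rcases eq_or_ne k n with rfl | hk
    · simp [seq_shift, shiftSeq]
    · simp [seq_shift, shiftSeq, hk]

theorem seq_adjoint_shift (x : L2 w hw) (n : ℕ) (hn : 1 ≤ n) :
    (ContinuousLinearMap.adjoint (shift hr hwr hM) x).seq n = x.seq (n + 1) := by
  have h := ContinuousLinearMap.adjoint_inner_left (shift hr hwr hM) (single n hn) x
  rw [shift_single, real_inner_smul_right, inner_single, inner_single, hwr n hn] at h
  have h1 := (hr n hn).ne'
  have h2 := (hw n hn).ne'
  field_simp at h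
  exact h

/-- If the ratios `r(k)` are eventually at most `θ < 1` then `1 - T` is bounded below. -/
theorem exists_pos_le_norm_sub_shift {θ : ℝ} {N : ℕ} (hr0 : 0 < r 0) (hθ : θ < 1)
    (hN : ∀ k, N ≤ k → r k ≤ θ) :
    ∃ δ : ℝ, 0 < δ ∧ ∀ x : L2 w hw, δ * ‖x‖ ^ 2 ≤ ‖x - shift hr hwr hM x‖ ^ 2 := by
  have hrp : ∀ k, 0 < r k := fun k => by
    rcases Nat.eq_zero_or_pos k with rfl | hk
    exacts [hr0, hr k hk]
  have hθ0 : 0 < θ := (hrp N).trans_le (hN N le_rfl)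
  set v : ℕ → ℝ := fun n => ∏ i ∈ Finset.range n, min 1 (θ / r i) with hv
  have hvs : ∀ n, v (n + 1) = v n * min 1 (θ / r n) := fun n => Finset.prod_range_succ _ _
  have hvpos : ∀ n, 0 < v n := fun n =>
    Finset.prod_pos fun i _ => lt_min one_pos (div_pos hθ0 (hrp i))
  have hv1 : ∀ n, v n ≤ 1 := fun n =>
    Finset.prod_le_one (fun i _ => (lt_min one_pos (div_pos hθ0 (hrp i))).le)
      fun i _ => min_le_left _ _
  have hvr : ∀ n, v (n + 1) * r n ≤ θ * v n := fun n => by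
    rw [hvs]
    have h1 : min 1 (θ / r n) * r n ≤ θ := (le_div_iff₀ (hrp n)).1 (min_le_right _ _)
    nlinarith [mul_le_mul_of_nonneg_left h1 (hvpos n).le]
  have hanti : Antitone v := antitone_nat_of_succ_le fun n => by
    rw [hvs]; exact mul_le_of_le_one_right (hvpos n).le (min_le_left _ _)
  have hconst : ∀ n, v N ≤ v (N + n) := fun n => by
    induction n with
    | zero => exact le_rfl
    | succ n ih =>
      rw [← add_assoc, hvs, min_eq_left, mul_one]
      · exact ih
      · exact (one_le_div (hrp _)).2 (hN _ (by omega))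
  have hvm : ∀ n, v N ≤ v n := fun n => by
    rcases le_total n N with h | h
    · exact hanti h
    · obtain ⟨j, rfl⟩ := Nat.exists_eq_add_of_le h
      exact hconst j
  set ε := (1 - θ) / 2 with hε
  have hεp : 0 < ε := by linarith
  set q := (1 + ε) * θ with hq
  have hq1 : 0 < 1 - q := by
    have : (1 + ε) * θ < 1 := by nlinarith
    linarith
  have hC : 0 < 1 + ε⁻¹ := by positivity
  refine ⟨(1 - q) * v N / (1 + ε⁻¹), by have := hvpos N; positivity, fun x => ?_⟩
  set z := x - shift hr hwr hM x with hz
  have hsum : Summable fun k => v k * (x.seq k ^ 2 * (w k)⁻¹) :=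
    Summable.of_nonneg_of_le (fun k => mul_nonneg (hvpos k).le (x.term_nonneg k))
      (fun k => mul_le_of_le_one_left (x.term_nonneg k) (hv1 k)) x.summable_sq
  have hstep : ∀ k, v (k + 1) * (x.seq (k + 1) ^ 2 * (w (k + 1))⁻¹) ≤
      (1 + ε⁻¹) * (z.seq (k + 1) ^ 2 * (w (k + 1))⁻¹) + q * (v k * (x.seq k ^ 2 * (w k)⁻¹)) := by
    intro k
    have hwi : 0 ≤ (w (k + 1))⁻¹ := (inv_pos.2 (hw (k + 1) (by omega))).le
    set s := shiftSeq r x.seq (k + 1) with hs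
    have h1 : x.seq (k + 1) = z.seq (k + 1) + s := by simp [hz, seq_shift, hs]
    have h2 : (z.seq (k + 1) + s) ^ 2 ≤ (1 + ε⁻¹) * z.seq (k + 1) ^ 2 + (1 + ε) * s ^ 2 := by
      have : (1 + ε⁻¹) * z.seq (k + 1) ^ 2 + (1 + ε) * s ^ 2 - (z.seq (k + 1) + s) ^ 2
          = ε⁻¹ * (z.seq (k + 1) - ε * s) ^ 2 := by field_simp; ring
      have h3 : 0 ≤ ε⁻¹ * (z.seq (k + 1) - ε * s) ^ 2 := by positivity
      linarith
    have h3 : s ^ 2 * (w (k + 1))⁻¹ = r k * (x.seq k ^ 2 * (w k)⁻¹) := shift_term hr hwr x k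
    calc v (k + 1) * (x.seq (k + 1) ^ 2 * (w (k + 1))⁻¹)
        ≤ v (k + 1) * (((1 + ε⁻¹) * z.seq (k + 1) ^ 2 + (1 + ε) * s ^ 2) * (w (k + 1))⁻¹) := by
          rw [h1]
          exact mul_le_mul_of_nonneg_left (mul_le_mul_of_nonneg_right h2 hwi) (hvpos _).le
      _ = v (k + 1) * ((1 + ε⁻¹) * (z.seq (k + 1) ^ 2 * (w (k + 1))⁻¹))
          + (1 + ε) * (v (k + 1) * (s ^ 2 * (w (k + 1))⁻¹)) := by ring
      _ ≤ (1 + ε⁻¹) * (z.seq (k + 1) ^ 2 * (w (k + 1))⁻¹)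
          + (1 + ε) * (θ * v k * (x.seq k ^ 2 * (w k)⁻¹)) := by
        gcongr ?_ + (1 + ε) * ?_
        · exact mul_le_of_le_one_left (mul_nonneg hC.le (z.term_nonneg _)) (hv1 _)
        · rw [h3, ← mul_assoc]
          exact mul_le_mul_of_nonneg_right (hvr k) (x.term_nonneg k)
      _ = _ := by rw [hq]; ring
  have htot : ∑' k, v k * (x.seq k ^ 2 * (w k)⁻¹) ≤
      (1 + ε⁻¹) * ‖z‖ ^ 2 + q * ∑' k, v k * (x.seq k ^ 2 * (w k)⁻¹) := by
    have hz1 : Summable fun k => (1 + ε⁻¹) * (z.seq (k + 1) ^ 2 * (w (k + 1))⁻¹) :=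
      ((summable_nat_add_iff 1).2 z.summable_sq).mul_left (1 + ε⁻¹)
    calc ∑' k, v k * (x.seq k ^ 2 * (w k)⁻¹)
        = ∑' k, v (k + 1) * (x.seq (k + 1) ^ 2 * (w (k + 1))⁻¹) := by
          rw [hsum.tsum_eq_zero_add]; simp
      _ ≤ ∑' k, ((1 + ε⁻¹) * (z.seq (k + 1) ^ 2 * (w (k + 1))⁻¹)
            + q * (v k * (x.seq k ^ 2 * (w k)⁻¹))) :=
          ((summable_nat_add_iff 1).2 hsum).tsum_le_tsum hstep (hz1.add (hsum.mul_left q))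
      _ = _ := by
        rw [hz1.tsum_add (hsum.mul_left q), tsum_mul_left, tsum_mul_left, norm_sq z,
          z.summable_sq.tsum_eq_zero_add]
        simp
  have hlow : v N * ‖x‖ ^ 2 ≤ ∑' k, v k * (x.seq k ^ 2 * (w k)⁻¹) := by
    rw [norm_sq, ← tsum_mul_left]
    exact (x.summable_sq.mul_left _).tsum_le_tsum
      (fun k => mul_le_mul_of_nonneg_right (hvm k) (x.term_nonneg k)) hsum
  rw [div_mul_eq_mul_div, div_le_iff₀ hC]
  nlinarith [mul_le_mul_of_nonneg_left hlow hq1.le]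

/-- A nonzero `x` with `‖x - T x‖ ≤ ‖x‖`, as soon as some ratio is at most `1`. -/
theorem exists_norm_sub_shift_le {n : ℕ} (hn : 1 ≤ n) (h : r (n + 1) ≤ 1) :
    ∃ x : L2 w hw, x ≠ 0 ∧ ‖x - shift hr hwr hM x‖ ^ 2 ≤ ‖x‖ ^ 2 := by
  set T := shift (hw := hw) hr hwr hM
  set e : L2 w hw := single n hn with he
  have hT1 : T e = r n • single (n + 1) (by omega) := shift_single hr hwr hM n hn
  have hT2 : T (T e) = r n • r (n + 1) • single (n + 2) (by omega) := by
    rw [hT1, map_smul]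
    exact congrArg _ (shift_single hr hwr hM (n + 1) (by omega))
  have hin1 : inner ℝ e (T e) = 0 := by
    rw [hT1, real_inner_smul_right, inner_single]; simp [he]
  have hin2 : inner ℝ e (T (T e)) = 0 := by
    rw [hT2, real_inner_smul_right, real_inner_smul_right, inner_single]; simp [he]
  have hle : ‖T (T e)‖ ^ 2 ≤ ‖T e‖ ^ 2 := by
    rw [hT2, hT1, norm_smul, norm_smul, norm_smul, mul_pow, mul_pow, mul_pow, norm_single_sq,
      norm_single_sq, hwr (n + 1) (by omega)]
    have h1 := hr (n + 1) (by omega)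
    have h2 := hw (n + 1) (by omega)
    refine mul_le_mul_of_nonneg_left ?_ (sq_nonneg _)
    rw [Real.norm_eq_abs, sq_abs]
    calc r (n + 1) ^ 2 * (r (n + 1) * w (n + 1))⁻¹ = r (n + 1) * (w (n + 1))⁻¹ := by field_simp
      _ ≤ (w (n + 1))⁻¹ := mul_le_of_le_one_left (inv_pos.2 h2).le h
  have hep : 0 < ‖e‖ ^ 2 := by
    rw [he, norm_single_sq]; exact inv_pos.2 (hw n hn)
  have hx : ‖e + T e‖ ^ 2 = ‖e‖ ^ 2 + ‖T e‖ ^ 2 := by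
    rw [norm_add_sq_real, hin1]; ring
  refine ⟨e + T e, fun h0 => ?_, ?_⟩
  · rw [h0] at hx
    have := sq_nonneg ‖T e‖
    simp at hx
    linarith
  · rw [hx, map_add, show e + T e - (T e + T (T e)) = e - T (T e) by abel, norm_sub_sq_real, hin2]
    linarith

end shift

end L2

/-- The ratio `π(k+1) / π(k)`. -/
def potentialRatio (ρ : ℝ) (L k : ℕ) : ℝ := L * ρ ^ L ^ k

theorem potentialRatio_pos {ρ : ℝ} {L : ℕ} (hρ : 0 < ρ) (hL : 1 ≤ L) (k : ℕ) :
    0 < potentialRatio ρ L k := by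
  have : (0 : ℝ) < L := by exact_mod_cast hL
  unfold potentialRatio
  positivity

theorem potentialRatio_le {ρ : ℝ} (hρ : 0 < ρ) (hρ1 : ρ ≤ 1) (L k : ℕ) :
    potentialRatio ρ L k ≤ L :=
  mul_le_of_le_one_right L.cast_nonneg (pow_le_one₀ hρ.le hρ1)

theorem potential_succ (ρ : ℝ) (L : ℕ) {k : ℕ} (hk : 1 ≤ k) :
    potential ρ L (k + 1) = potentialRatio ρ L k * potential ρ L k := by
  obtain ⟨j, rfl⟩ : ∃ j, k = j + 1 := ⟨k - 1, by omega⟩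
  simp only [potential, potentialRatio, Finset.sum_Ico_succ_top hk, Nat.add_sub_cancel]
  ring

theorem exists_potentialRatio_le {ρ : ℝ} (hρ : 0 < ρ) (hρ1 : ρ < 1) {L : ℕ} (hL : 1 ≤ L) :
    ∃ θ : ℝ, θ < 1 ∧ ∃ N, ∀ k, N ≤ k → potentialRatio ρ L k ≤ θ := by
  rcases hL.eq_or_lt with rfl | hL
  · exact ⟨ρ, hρ1, 0, fun k _ => by simp [potentialRatio]⟩
  · have hlim : Filter.Tendsto (fun k => (L : ℝ) * ρ ^ k) Filter.atTop (nhds 0) := by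
      simpa using (tendsto_pow_atTop_nhds_zero_of_lt_one hρ.le hρ1).const_mul (L : ℝ)
    obtain ⟨N, hN⟩ := Filter.eventually_atTop.1
      (hlim.eventually (ge_mem_nhds (by norm_num : (0 : ℝ) < 1 / 2)))
    refine ⟨1 / 2, by norm_num, N, fun k hk => le_trans ?_ (hN k hk)⟩
    exact mul_le_mul_of_nonneg_left
      (pow_le_pow_of_le_one hρ.le hρ1.le (Nat.lt_pow_self hL).le) L.cast_nonneg

theorem seq_negGram_shift {α β : ℝ} {L : ℕ} (hβ : 0 < β) (hL : 1 ≤ L) {w : ℕ → ℝ}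
    {hw : ∀ k, 1 ≤ k → 0 < w k} {M : ℝ} (hr : ∀ k, 1 ≤ k → 0 < potentialRatio (α / β) L k)
    (hwr : ∀ k, 1 ≤ k → w (k + 1) = potentialRatio (α / β) L k * w k)
    (hM : ∀ k, potentialRatio (α / β) L k ≤ M) (x : L2 w hw) :
    (negGram β (L2.shift hr hwr hM) x).seq = linK α β L x.seq := by
  funext k
  cases k with
  | zero => simp [linK]
  | succ k =>
    rw [linK_succ hβ.ne' hL, negGram_apply, L2.seq_neg, L2.seq_smul, L2.seq_sub, Pi.neg_apply,
      Pi.smul_apply, Pi.sub_apply, L2.seq_adjoint_shift _ _ _ _ _ (by omega)]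
    simp only [L2.seq_sub, Pi.sub_apply, smul_eq_mul, L2.seq_shift, L2.shiftSeq, potentialRatio]
    ring

end QueueGap

end

open QueueGap L2 in
theorem mainTheorem3 (α β : ℝ) (L : ℕ) (hα : 0 < α) (hαβ : α < β) (hL : 1 ≤ L) :
    ∃ 𝒦 : QueueGap.L2Pi (α / β) L (div_pos hα (hα.trans hαβ)) hL →L[ℝ]
          QueueGap.L2Pi (α / β) L (div_pos hα (hα.trans hαβ)) hL,
      (∀ x, (𝒦 x).seq = QueueGap.linK α β L x.seq) ∧
      IsSelfAdjoint 𝒦 ∧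
      ∃ γ : ℝ, IsLeast (spectrum ℝ (-𝒦)) γ ∧ 0 < γ ∧ γ ≤ β ∧
        (∀ z₀, ∀ t : ℝ, 0 ≤ t →
          HasDerivWithinAt (fun s : ℝ => NormedSpace.exp (s • 𝒦) z₀)
            (𝒦 (NormedSpace.exp (t • 𝒦) z₀)) (Set.Ici 0) t) ∧
        (∀ z : ℝ → QueueGap.L2Pi (α / β) L (div_pos hα (hα.trans hαβ)) hL,
          (∀ t : ℝ, 0 ≤ t → HasDerivWithinAt z (𝒦 (z t)) (Set.Ici 0) t) →
          ∀ t : ℝ, 0 ≤ t → z t = NormedSpace.exp (t • 𝒦) (z 0)) ∧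
        (∀ z₀, ∀ t : ℝ, 0 ≤ t →
          ‖NormedSpace.exp (t • 𝒦) z₀‖ ≤ Real.exp (-γ * t) * ‖z₀‖) := by
  have hβ : 0 < β := hα.trans hαβ
  have hρ : 0 < α / β := div_pos hα hβ
  have hρ1 : α / β < 1 := (div_lt_one hβ).2 hαβ
  obtain ⟨θ, hθ, N, hN⟩ := exists_potentialRatio_le hρ hρ1 hL
  have hr : ∀ k, 1 ≤ k → 0 < potentialRatio (α / β) L k := fun k _ => potentialRatio_pos hρ hL k
  have hwr : ∀ k, 1 ≤ k → potential (α / β) L (k + 1)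
      = potentialRatio (α / β) L k * potential (α / β) L k := fun k hk => potential_succ _ _ hk
  have hM := potentialRatio_le hρ hρ1.le L
  obtain ⟨δ, hδ, hlow⟩ := exists_pos_le_norm_sub_shift (hw := potential_pos hρ hL) hr hwr hM
    (potentialRatio_pos hρ hL 0) hθ hN
  obtain ⟨x, hx0, hx⟩ := exists_norm_sub_shift_le (hw := potential_pos hρ hL) hr hwr hM
    (n := N + 1) (by omega) ((hN _ (by omega)).trans hθ.le)
  obtain ⟨γ, hspec, hγ, hγβ, hmem⟩ := exists_gap_negGram hβ hδ hlow hx0 hx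
  refine ⟨negGram β (shift hr hwr hM), seq_negGram_shift hβ hL hr hwr hM,
    isSelfAdjoint_negGram _ _, γ, hspec, hγ, hγβ,
    fun z t _ => (hasDerivAt_exp_smul_apply _ z t).hasDerivWithinAt,
    fun z hz t ht => eq_exp_smul_apply_of_hasDerivWithinAt _ hz ht,
    fun z t ht => norm_exp_smul_apply_le hmem z ht⟩
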